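/- Let $\omega=\omega(n)\le n$ be any real function of $n\in\mathbb N$ that tends to infinity as $n\to\infty$, let $p=p(n)=\omega/n$, and let $G=\mathcal G(n,p)$ be the binomial random graph on the vertex set $[n]=\{1,\dots,n\}$, in which each of the $\binom n2$ pairs of vertices is an edge independently with probability $p$. A \emph{set-pairing} is a pair $(S,\mathcal P)$ where $S\subseteq[n]$ has even size and $\mathcal P=\{\{v_1,v_2\},\{v_3,v_4\},\dots,\{v_{|S|-1},v_{|S|}\}\}$ for some ordering $v_1,\dots,v_{|S|}$ of the elements of $S$; write $(S',\mathcal P')\subseteq(S,\mathcal P)$ if $S'\subseteq S$ and $\mathcal P'\subseteq\mathcal P$. Then, with probability tending to $1$ as $n\to\infty$, the following holds: for every set-pairing $(S,\mathcal P)$ with $|S|\ge 510\,n/\sqrt{\omega}$ there is a set-pairing $(S',\mathcal P')\subseteq(S,\mathcal P)$ with $S'\ne\varnothing$ such that the induced subgraph $G[S']$ has a Hamilton path (a path in $G[S']$ through all vertices of $S'$). -/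

import Mathlib

open Filter Topology MeasureTheory ProbabilityTheory
open scoped unitInterval

/-- A set-pairing on the vertex set `V`: a finite set `S` of vertices together with a partition of
`S` into two-element sets, i.e. a set of the form `{{v₁, v₂}, {v₃, v₄}, …}` for some ordering
`v₁, v₂, …` of the elements of `S` (so `S` automatically has even size). -/
structure SetPairing (V : Type*) [DecidableEq V] where
  /-- the underlying set of vertices -/
  S : Finset V
  /-- the pairs -/
  pairing : Finpartition S
  card_eq_two : ∀ e ∈ pairing.parts, e.card = 2

namespace SetPairing

variable {V : Type*} [DecidableEq V]

/-- `(S', 𝒫') ⊆ (S, 𝒫)` iff `S' ⊆ S` and `𝒫' ⊆ 𝒫`. -/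
instance : HasSubset (SetPairing V) :=
  ⟨fun Q P => Q.S ⊆ P.S ∧ Q.pairing.parts ⊆ P.pairing.parts⟩

theorem even_card (P : SetPairing V) : Even P.S.card := by
  rw [← P.pairing.sum_card_parts, Finset.sum_congr rfl P.card_eq_two]
  simp

end SetPairing

/-- `G` has a Hamilton path: a walk in `G` that visits every vertex exactly once. -/
def HasHamiltonPath {V : Type*} [DecidableEq V] (G : SimpleGraph V) : Prop :=
  ∃ (a b : V) (w : G.Walk a b), w.IsHamiltonian

/-! Write `p = 1 - (1 - q)^2`, so that `G` is the union of two independent rounds `G₁`, `G₂` of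
density `q ≥ p/2`. Put `x = n/√ω` and `k = ⌈10x⌉`; then `q k² ≥ 50n`, which beats every union bound
over vertex sets.

In `G₁` any two disjoint `k`-sets are joined by an edge. This alone forces every pairing on at least
`11k` vertices to contain one whose vertex set `T` expands threefold on sets of size up to `k`:
delete a largest badly expanding set together with all pairs it meets
(`SetPairing.exists_isExpander`).

By Pósa rotations, as long as a graph containing such an expander has no path spanning `T`, at least
`k²/2` non-edges in `T` are boosters, i.e. lengthen a longest path
(`IsExpander.sq_le_card_boosters`). If `G₁ ∪ G₂` has no spanning path, some set `F ⊆ G₂` of at most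
`|T|` edges has the property that `G₂` misses all boosters of `G₁ + F` (`exists_disjoint_boosters`).
For fixed `T` and `F` this has probability at most `q^|F| exp(-q k²/2)`. Trimming the pairing
beforehand gives `|T| ≤ 512x`, so the sum over `F` costs only `exp(2n)`, and the one over `T` only
`2^n`. -/

namespace SimpleGraph

/-! ### Paths as lists and Pósa rotations. -/

variable {V : Type*}

/-- The list `l` is a path of `G` all of whose vertices lie in `T`. -/
structure IsPathList (G : SimpleGraph V) (T : Finset V) (l : List V) : Prop where
  isChain : l.IsChain G.Adj
  nodup : l.Nodup
  subset : ∀ v ∈ l, v ∈ T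

theorem IsPathList.mono {G H : SimpleGraph V} {T : Finset V} {l : List V} (h : G.IsPathList T l)
    (hGH : G ≤ H) : H.IsPathList T l :=
  ⟨h.isChain.imp fun _ _ hab => hGH hab, h.nodup, h.subset⟩

theorem IsPathList.length_le [DecidableEq V] {G : SimpleGraph V} {T : Finset V} {l : List V}
    (h : G.IsPathList T l) : l.length ≤ T.card := by
  rw [← List.toFinset_card_of_nodup h.nodup]
  exact Finset.card_le_card fun v hv => h.subset v (List.mem_toFinset.1 hv)

theorem IsPathList.reverse {G : SimpleGraph V} {T : Finset V} {l : List V}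
    (h : G.IsPathList T l) : G.IsPathList T l.reverse := by
  refine ⟨?_, List.nodup_reverse.2 h.nodup, fun v hv => h.subset v (List.mem_reverse.1 hv)⟩
  rw [List.isChain_reverse]
  exact h.isChain.imp fun _ _ hab => hab.symm

/-- `a` and `b` are consecutive, in some order, in the list `l`. -/
def Consecutive (l : List V) (a b : V) : Prop :=
  ∃ A B, l = A ++ a :: b :: B ∨ l = A ++ b :: a :: B

/-- `l'` arises from `l` by a Pósa rotation at the head of `l`. -/
def Rotation (G : SimpleGraph V) (l l' : List V) : Prop :=
  ∃ u X w B, l = u :: X ++ w :: B ∧ G.Adj u w ∧ l' = (u :: X).reverse ++ w :: B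

theorem Rotation.length_eq {G : SimpleGraph V} {l l' : List V} (h : G.Rotation l l') :
    l'.length = l.length := by
  obtain ⟨u, X, w, B, rfl, -, rfl⟩ := h
  simp
  omega

theorem Rotation.getLast?_eq {G : SimpleGraph V} {l l' : List V} (h : G.Rotation l l') :
    l'.getLast? = l.getLast? := by
  obtain ⟨u, X, w, B, rfl, -, rfl⟩ := h
  rw [List.getLast?_append, List.getLast?_append]
  cases B <;> simp [List.getLast?_cons]

theorem Rotation.isPathList {G : SimpleGraph V} {T : Finset V} {l l' : List V}
    (h : G.Rotation l l') (hl : G.IsPathList T l) : G.IsPathList T l' := by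
  obtain ⟨u, X, w, B, rfl, huw, rfl⟩ := h
  obtain ⟨h1, h2, h3⟩ := hl
  refine ⟨?_, ?_, fun v hv => h3 v ?_⟩
  · rw [List.isChain_append] at h1 ⊢
    refine ⟨?_, h1.2.1, ?_⟩
    · rw [List.isChain_reverse]
      exact h1.1.imp fun _ _ hab => hab.symm
    · intro x hx y hy
      simp at hx hy
      subst hx hy
      exact huw
  · refine (List.Perm.nodup_iff ?_).1 h2
    exact (List.reverse_perm _).symm.append_right _
  · simp only [List.mem_append, List.mem_reverse] at hv ⊢
    exact hv

theorem consecutive_append {X Y : List V} {a b : V} (h : Consecutive (X ++ Y) a b) :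
    Consecutive X a b ∨ Consecutive Y a b ∨ (a ∈ X.getLast? ∧ b ∈ Y.head?) ∨
      (b ∈ X.getLast? ∧ a ∈ Y.head?) := by
  have key : ∀ a b A B, X ++ Y = A ++ a :: b :: B → (∃ A B, X = A ++ a :: b :: B) ∨
      (∃ A B, Y = A ++ a :: b :: B) ∨ (a ∈ X.getLast? ∧ b ∈ Y.head?) := by
    intro a b A B h
    rcases List.append_eq_append_iff.1 h with ⟨C, rfl, rfl⟩ | ⟨C, rfl, h2⟩
    · exact .inr (.inl ⟨C, B, rfl⟩)
    · rcases C with _ | ⟨c, _ | ⟨d, C⟩⟩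
      · simp only [List.nil_append] at h2
        exact .inr (.inl ⟨[], B, h2.symm⟩)
      · simp only [List.cons_append, List.nil_append, List.cons.injEq] at h2
        obtain ⟨rfl, rfl⟩ := h2
        simp
      · simp only [List.cons_append, List.cons.injEq] at h2
        obtain ⟨rfl, rfl, rfl⟩ := h2
        exact .inl ⟨A, C, rfl⟩
  obtain ⟨A, B, h | h⟩ := h
  · rcases key _ _ _ _ h with ⟨A, B, h⟩ | ⟨A, B, h⟩ | h
    exacts [.inl ⟨A, B, .inl h⟩, .inr (.inl ⟨A, B, .inl h⟩), .inr (.inr (.inl h))]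
  · rcases key _ _ _ _ h with ⟨A, B, h⟩ | ⟨A, B, h⟩ | h
    exacts [.inl ⟨A, B, .inr h⟩, .inr (.inl ⟨A, B, .inr h⟩), .inr (.inr (.inr h))]

theorem Consecutive.append_left {Y : List V} {a b : V} (X : List V) (h : Consecutive Y a b) :
    Consecutive (X ++ Y) a b := by
  obtain ⟨A, B, rfl | rfl⟩ := h
  exacts [⟨X ++ A, B, .inl (by simp)⟩, ⟨X ++ A, B, .inr (by simp)⟩]

theorem Consecutive.append_right {X : List V} {a b : V} (Y : List V) (h : Consecutive X a b) :
    Consecutive (X ++ Y) a b := by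
  obtain ⟨A, B, rfl | rfl⟩ := h
  exacts [⟨A, B ++ Y, .inl (by simp)⟩, ⟨A, B ++ Y, .inr (by simp)⟩]

theorem Consecutive.reverse {X : List V} {a b : V} (h : Consecutive X a b) :
    Consecutive X.reverse a b := by
  obtain ⟨A, B, rfl | rfl⟩ := h
  exacts [⟨B.reverse, A.reverse, .inr (by simp)⟩, ⟨B.reverse, A.reverse, .inl (by simp)⟩]

/-- An entry occurs only once, so its predecessor and successor on a path are unique. -/
theorem append_cons_inj_of_nodup {A A' B B' : List V} {a : V} (h : A ++ a :: B = A' ++ a :: B')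
    (hn : (A ++ a :: B).Nodup) : A = A' ∧ B = B' := by
  have hn' := h ▸ hn
  rw [List.nodup_append] at hn hn'
  have h1 : a ∉ A := fun ha => hn.2.2 a ha a (by simp) rfl
  have h2 : a ∉ A' := fun ha => hn'.2.2 a ha a (by simp) rfl
  rcases List.append_eq_append_iff.1 h with ⟨C, rfl, h3⟩ | ⟨C, rfl, h3⟩ <;>
  rcases C with _ | ⟨c, C⟩ <;> simp_all

open Classical in
/-- The vertices of `T` outside `U` that have a neighbour in `U`. -/
noncomputable def outerNeighbors (G : SimpleGraph V) (T U : Finset V) : Finset V :=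
  (T \ U).filter fun v => ∃ u ∈ U, G.Adj u v

theorem mem_outerNeighbors {G : SimpleGraph V} {T U : Finset V} {v : V} :
    v ∈ G.outerNeighbors T U ↔ (v ∈ T ∧ v ∉ U) ∧ ∃ u ∈ U, G.Adj u v := by
  simp [outerNeighbors]

/-- The reachable end points of a longest path, the other end point being fixed, have few
neighbours. -/
theorem exists_rotation_ends (G : SimpleGraph V) (T : Finset V) (l₀ : List V)
    (hl₀ : G.IsPathList T l₀) (hmax : ∀ l, G.IsPathList T l → l.length ≤ l₀.length)
    (hne : l₀ ≠ []) :
    ∃ R ⊆ T, R.Nonempty ∧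
      (∀ r ∈ R, ∃ l, G.IsPathList T l ∧ l.length = l₀.length ∧ r ∈ l.head? ∧
        l.getLast? = l₀.getLast?) ∧
      (G.outerNeighbors T R).card ≤ 2 * R.card := by
  classical
  let Reach := Relation.ReflTransGen G.Rotation l₀
  have hreach : ∀ l, Reach l → G.IsPathList T l ∧ l.length = l₀.length ∧
      l.getLast? = l₀.getLast? := by
    intro l h
    induction h with
    | refl => exact ⟨hl₀, rfl, rfl⟩
    | tail _ h ih => exact ⟨h.isPathList ih.1, h.length_eq.trans ih.2.1,
        h.getLast?_eq.trans ih.2.2⟩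
  let R := T.filter fun r => ∃ l, Reach l ∧ r ∈ l.head?
  have hR : ∀ l r, Reach l → r ∈ l.head? → r ∈ R := fun l r h hr =>
    Finset.mem_filter.2 ⟨(hreach l h).1.subset r (List.mem_of_mem_head? hr), l, h, hr⟩
  -- A rotation creates a single new adjacency, between the old end `u ∈ R` and the pivot. If the
  -- pivot is `w`, its lost path-neighbour becomes the new end, hence lies in `R`, contrary to
  -- assumption.
  have hinv : ∀ l, Reach l → ∀ w ∉ R, (∀ y, Consecutive l₀ w y → y ∉ R) →
      ∀ y, Consecutive l w y → Consecutive l₀ w y := by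
    intro l h w hw hwy
    induction h with
    | refl => exact fun y h => h
    | @tail l l' hl h ih =>
      intro y hy
      have hl' := hl.tail h
      obtain ⟨u, X, x, B, rfl, hux, rfl⟩ := h
      have hu : u ∈ R := hR _ _ hl (by simp)
      rcases consecutive_append hy with h1 | h1 | ⟨h1, h2⟩ | ⟨h1, h2⟩
      · refine ih y (Consecutive.append_right _ ?_)
        simpa using h1.reverse
      · exact ih y (h1.append_left _)
      · simp at h1
        subst h1
        exact absurd hu hw
      · simp at h2
        subst h2
        rcases List.eq_nil_or_concat (u :: X) with h3 | ⟨Z, z, h3⟩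
        · simp at h3
        · exfalso
          rw [List.concat_eq_append] at h3
          refine hwy z (ih z ?_) (hR _ _ hl' ?_)
          · rw [h3]
            exact ⟨Z, B, .inr (by simp)⟩
          · rw [h3]
            simp
  refine ⟨R, Finset.filter_subset _ _, ?_, ?_, ?_⟩
  · obtain ⟨u, t, rfl⟩ := List.exists_cons_of_ne_nil hne
    exact ⟨u, hR _ u .refl (by simp)⟩
  · intro r hr
    obtain ⟨-, l, hl, hr⟩ := Finset.mem_filter.1 hr
    exact ⟨l, (hreach l hl).1, (hreach l hl).2.1, hr, (hreach l hl).2.2⟩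
  · have hcons : ∀ w ∈ G.outerNeighbors T R,
        ∃ y ∈ R, Consecutive l₀ w y := by
      intro w hw
      obtain ⟨⟨hwT, hwR⟩, u, hu, huw⟩ := mem_outerNeighbors.1 hw
      by_contra hcon
      push Not at hcon
      have hcon' : ∀ y, Consecutive l₀ w y → y ∉ R := fun y h1 h2 => hcon y h2 h1
      obtain ⟨-, l, hl, hul⟩ := Finset.mem_filter.1 hu
      obtain ⟨hp, hlen, -⟩ := hreach l hl
      obtain ⟨t, rfl⟩ : ∃ t, l = u :: t := by
        rcases l with _ | ⟨a, t⟩ <;> simp_all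
      have hwl : w ∈ u :: t := by
        by_contra hwl
        have := hmax (w :: u :: t) ⟨?_, List.nodup_cons.2 ⟨hwl, hp.nodup⟩, ?_⟩
        · simp at this hlen
          omega
        · exact List.isChain_cons_cons.2 ⟨huw.symm, hp.isChain⟩
        · intro v hv
          rcases List.mem_cons.1 hv with rfl | hv
          exacts [hwT, hp.subset v hv]
      have hwt : w ∈ t := by
        rcases List.mem_cons.1 hwl with rfl | h
        exacts [absurd hu hwR, h]
      obtain ⟨X, B, rfl⟩ := List.append_of_mem hwt
      have hrot : Reach ((u :: X).reverse ++ w :: B) := hl.tail ⟨u, X, w, B, rfl, huw, rfl⟩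
      rcases List.eq_nil_or_concat (u :: X) with h3 | ⟨Z, z, h3⟩
      · simp at h3
      · rw [List.concat_eq_append] at h3
        refine hcon' z (hinv _ hl w hwR hcon' z ?_) (hR _ _ hrot ?_)
        · rw [← List.cons_append, h3]
          exact ⟨Z, B, .inr (by simp)⟩
        · rw [h3]
          simp
    have hn := hl₀.nodup
    have h1 : ((G.outerNeighbors T R).filter
        fun w => ∃ y ∈ R, ∃ A B, l₀ = A ++ w :: y :: B).card ≤ R.card := by
      refine Finset.card_le_card_of_forall_subsingleton
        (fun w y => ∃ A B, l₀ = A ++ w :: y :: B) (fun w hw => (Finset.mem_filter.1 hw).2) ?_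
      rintro y - w ⟨-, A, B, h⟩ w' ⟨-, A', B', h'⟩
      have := append_cons_inj_of_nodup (A := A ++ [w]) (A' := A' ++ [w']) (a := y) (B := B)
        (B' := B') (by simp [← h, ← h']) (by simpa [← h] using hn)
      simpa using (List.append_inj' this.1 rfl).2
    have h2 : ((G.outerNeighbors T R).filter
        fun w => ∃ y ∈ R, ∃ A B, l₀ = A ++ y :: w :: B).card ≤ R.card := by
      refine Finset.card_le_card_of_forall_subsingleton
        (fun w y => ∃ A B, l₀ = A ++ y :: w :: B) (fun w hw => (Finset.mem_filter.1 hw).2) ?_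
      rintro y - w ⟨-, A, B, h⟩ w' ⟨-, A', B', h'⟩
      have := append_cons_inj_of_nodup (h.symm.trans h') (h ▸ hn)
      exact (List.cons.inj this.2).1
    rw [two_mul]
    refine le_trans (Finset.card_le_card ?_)
      ((Finset.card_union_le _ _).trans (add_le_add h1 h2))
    intro w hw
    obtain ⟨y, hy, A, B, h | h⟩ := hcons w hw
    · exact Finset.mem_union_left _ (Finset.mem_filter.2 ⟨hw, y, hy, A, B, h⟩)
    · exact Finset.mem_union_right _ (Finset.mem_filter.2 ⟨hw, y, hy, A, B, h⟩)

end SimpleGraph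

/-! ### Expanders, longest paths and boosters. -/

namespace SimpleGraph

variable {V : Type*}

/-- Any two disjoint sets of at least `k` vertices are joined by an edge. -/
def Joined (G : SimpleGraph V) (k : ℕ) : Prop :=
  ∀ X Y : Finset V, Disjoint X Y → k ≤ X.card → k ≤ Y.card → ∃ x ∈ X, ∃ y ∈ Y, G.Adj x y

/-- `G` is joined, and in the subgraph induced by `T` small sets expand. -/
structure IsExpander (G : SimpleGraph V) (T : Finset V) (k : ℕ) : Prop where
  joined : G.Joined k
  expand : ∀ U ⊆ T, U.Nonempty → U.card ≤ k → 3 * U.card ≤ (G.outerNeighbors T U).card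

theorem outerNeighbors_mono {G H : SimpleGraph V} (hGH : G ≤ H) (T U : Finset V) :
    G.outerNeighbors T U ⊆ H.outerNeighbors T U := by
  intro v hv
  rw [mem_outerNeighbors] at hv ⊢
  exact ⟨hv.1, hv.2.imp fun u hu => ⟨hu.1, hGH hu.2⟩⟩

theorem IsExpander.mono {G H : SimpleGraph V} {T : Finset V} {k : ℕ} (h : G.IsExpander T k)
    (hGH : G ≤ H) : H.IsExpander T k where
  joined X Y hXY hX hY := by
    obtain ⟨x, hx, y, hy, hxy⟩ := h.joined X Y hXY hX hY
    exact ⟨x, hx, y, hy, hGH hxy⟩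
  expand U hU hne hc :=
    (h.expand U hU hne hc).trans (Finset.card_le_card (outerNeighbors_mono hGH T U))

open Classical in
/-- The number of vertices of a longest path of `G` with all vertices in `T`. -/
noncomputable def longestPath (G : SimpleGraph V) (T : Finset V) : ℕ :=
  Nat.findGreatest (fun m => ∃ l, G.IsPathList T l ∧ l.length = m) T.card

theorem longestPath_le (G : SimpleGraph V) (T : Finset V) : G.longestPath T ≤ T.card := by
  classical
  exact Nat.findGreatest_le _

theorem exists_longestPath (G : SimpleGraph V) (T : Finset V) :
    ∃ l, G.IsPathList T l ∧ l.length = G.longestPath T := by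
  classical
  exact Nat.findGreatest_spec (P := fun m => ∃ l, G.IsPathList T l ∧ l.length = m)
    (Nat.zero_le _) ⟨[], ⟨by simp, by simp, by simp⟩, rfl⟩

theorem IsPathList.length_le_longestPath {G : SimpleGraph V} {T : Finset V} {l : List V}
    (h : G.IsPathList T l) : l.length ≤ G.longestPath T := by
  classical
  exact Nat.le_findGreatest h.length_le ⟨l, h, rfl⟩

/-- In an expander, a path which does not span and whose end points are adjacent is not longest. -/
theorem IsExpander.lt_longestPath {G H : SimpleGraph V} {T : Finset V} {k : ℕ}
    (hG : G.IsExpander T k) (hGH : G ≤ H) {l : List V} {a b : V} (hl : H.IsPathList T l)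
    (ha : a ∈ l.head?) (hb : b ∈ l.getLast?) (hab : a ≠ b → H.Adj a b)
    (hlT : l.length < T.card) : l.length < H.longestPath T := by
  classical
  -- Connectivity of `T`: expansion applies if the path or its complement has at most `k` vertices;
  -- otherwise joinedness does.
  have hout : ∃ c ∈ l, ∃ z ∈ T, z ∉ l ∧ G.Adj z c := by
    have hne : l ≠ [] := by rintro rfl; simp at ha
    have hcard := List.toFinset_card_of_nodup hl.nodup
    have hsub : l.toFinset ⊆ T := fun v hv => hl.subset v (List.mem_toFinset.1 hv)
    have hZ := Finset.card_sdiff_of_subset hsub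
    by_cases h1 : l.toFinset.card ≤ k
    · have := hG.expand _ hsub (by simpa [Finset.nonempty_iff_ne_empty] using hne) h1
      have hpos : 0 < (G.outerNeighbors T l.toFinset).card := by
        have := List.length_pos_iff.2 hne
        omega
      obtain ⟨z, hz⟩ := Finset.card_pos.1 hpos
      obtain ⟨⟨hzT, hzl⟩, c, hc, hcz⟩ := mem_outerNeighbors.1 hz
      exact ⟨c, by simpa using hc, z, hzT, by simpa using hzl, hcz.symm⟩
    · by_cases h2 : (T \ l.toFinset).card ≤ k
      · have := hG.expand (T \ l.toFinset) Finset.sdiff_subset (Finset.card_pos.1 (by omega)) h2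
        have hpos : 0 < (G.outerNeighbors T (T \ l.toFinset)).card := by omega
        obtain ⟨c, hc⟩ := Finset.card_pos.1 hpos
        obtain ⟨⟨hcT, hcl⟩, z, hz, hcz⟩ := mem_outerNeighbors.1 hc
        simp at hz hcl
        exact ⟨c, hcl hcT, z, hz.1, hz.2, hcz⟩
      · obtain ⟨c, hc, z, hz, hcz⟩ := hG.joined l.toFinset (T \ l.toFinset)
          Finset.disjoint_sdiff (by omega) (by omega)
        simp at hc hz
        exact ⟨c, hc, z, hz.1, hz.2, hcz.symm⟩
  obtain ⟨c, hc, z, hzT, hzl, hzc⟩ := hout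
  obtain ⟨X, Y, rfl⟩ := List.append_of_mem hc
  have hperm : (c :: Y ++ X).Perm (X ++ c :: Y) := List.perm_append_comm
  -- Close the path to a cycle with the edge `ba`, cut it just before `c` and prepend `z`. If `X` is
  -- empty no closing edge is needed, which covers `a = b`.
  have hnew : H.IsPathList T (z :: c :: Y ++ X) := by
    refine ⟨?_, ?_, ?_⟩
    · rw [List.cons_append, List.cons_append, List.isChain_cons_cons]
      refine ⟨hGH hzc, ?_⟩
      rw [← List.cons_append]
      have h1 := hl.isChain
      rw [List.isChain_append] at h1 ⊢
      refine ⟨h1.2.1, h1.1, fun x hx y hy => ?_⟩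
      have hxb : x = b := by
        rw [List.getLast?_append] at hb
        rw [Option.mem_def] at hx
        rw [hx] at hb
        simpa using hb
      have hya : y = a := by
        rcases X with _ | ⟨d, X⟩
        · simp at hy
        · simp at hy ha
          rw [← hy, ha]
      subst hxb hya
      refine (hab ?_).symm
      rintro rfl
      exact (List.nodup_append.1 hl.nodup).2.2 _ (List.mem_of_mem_head? hy) _
        (List.mem_of_mem_getLast? hx) rfl
    · rw [List.cons_append, List.nodup_cons]
      exact ⟨fun h => hzl (hperm.mem_iff.1 h), hperm.nodup_iff.2 hl.nodup⟩
    · intro v hv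
      rw [List.cons_append, List.mem_cons] at hv
      rcases hv with rfl | hv
      exacts [hzT, hl.subset v (hperm.mem_iff.1 hv)]
  have := hnew.length_le_longestPath
  simp at this ⊢
  omega

open Classical in
/-- The non-edges of `G` inside `T` whose addition to `G` produces a longer path in `T`. -/
noncomputable def boosters (G : SimpleGraph V) (T : Finset V) : Finset (Sym2 V) :=
  T.sym2.filter fun e => ¬ e.IsDiag ∧ e ∉ G.edgeSet ∧
    G.longestPath T < (G ⊔ fromEdgeSet {e}).longestPath T

theorem mem_boosters {G : SimpleGraph V} {T : Finset V} {e : Sym2 V} :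
    e ∈ G.boosters T ↔ e ∈ T.sym2 ∧ ¬ e.IsDiag ∧ e ∉ G.edgeSet ∧
      G.longestPath T < (G ⊔ fromEdgeSet {e}).longestPath T := by
  simp [boosters]

/-- With one end of a longest path fixed, rotations give at least `k` other ends; fixing each of
these in turn gives `k` more. The `k²` ordered pairs of ends are boosters, each counted at most
twice. -/
theorem IsExpander.sq_le_card_boosters {G : SimpleGraph V} {T : Finset V} {k : ℕ}
    (hG : G.IsExpander T k) (hT : T.Nonempty) (hlt : G.longestPath T < T.card) :
    k ^ 2 ≤ 2 * (G.boosters T).card := by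
  classical
  let Ends : V → V → Prop := fun a b => ∃ l, G.IsPathList T l ∧ l.length = G.longestPath T ∧
    a ∈ l.head? ∧ b ∈ l.getLast?
  have hsymm : ∀ a b, Ends a b → Ends b a := by
    rintro a b ⟨l, hl, hlen, ha, hb⟩
    exact ⟨l.reverse, hl.reverse, by simpa using hlen, by simpa using hb, by simpa using ha⟩
  have hpos : 0 < G.longestPath T := by
    obtain ⟨v, hv⟩ := hT
    have : G.IsPathList T [v] := ⟨by simp, by simp, by simpa using hv⟩
    exact this.length_le_longestPath
  have hdeg : ∀ a b, Ends a b → k ≤ (T.filter fun c => Ends c b).card := by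
    rintro a b ⟨l, hl, hlen, ha, hb⟩
    obtain ⟨R, hRT, hRne, hR, hN⟩ := exists_rotation_ends G T l hl
      (fun l' hl' => hlen ▸ hl'.length_le_longestPath) (by rintro rfl; simp at ha)
    -- The end set has at most `2|R|` outer neighbours, against `3|R|` if it were small.
    have hkR : k ≤ R.card := by
      by_contra hcon
      have h1 := hG.expand R hRT hRne (by omega)
      have := hRne.card_pos
      omega
    refine hkR.trans (Finset.card_le_card fun r hr => ?_)
    obtain ⟨l', hl', hlen', hr', hlast⟩ := hR r hr
    exact Finset.mem_filter.2 ⟨hRT hr, l', hl', hlen'.trans hlen, hr', hlast ▸ hb⟩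
  obtain ⟨a₀, b₀, h₀⟩ : ∃ a b, Ends a b := by
    obtain ⟨l, hl, hlen⟩ := G.exists_longestPath T
    have hne : l ≠ [] := by
      rintro rfl
      simp at hlen
      omega
    exact ⟨l.head hne, l.getLast hne, l, hl, hlen, by simp [List.head?_eq_some_head hne],
      by simp [List.getLast?_eq_some_getLast hne]⟩
  let A := T.filter fun c => Ends c b₀
  let W := (T ×ˢ T).filter fun x => Ends x.1 x.2
  have hW : k ^ 2 ≤ W.card := by
    calc k ^ 2 = k * k := sq k
      _ ≤ A.card * k := Nat.mul_le_mul_right _ (hdeg _ _ h₀)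
      _ ≤ ∑ a ∈ A, (T.filter fun c => Ends c a).card := by
        rw [← smul_eq_mul]
        refine Finset.card_nsmul_le_sum _ _ _ fun a ha => ?_
        exact hdeg b₀ a (hsymm _ _ (Finset.mem_filter.1 ha).2)
      _ = (A.sigma fun a => T.filter fun c => Ends c a).card := (Finset.card_sigma _ _).symm
      _ ≤ W.card := by
        refine Finset.card_le_card_of_injOn (fun x => (x.2, x.1)) ?_ ?_
        · rintro ⟨a, c⟩ h
          simp only [Finset.coe_sigma, Set.mem_sigma_iff, Finset.mem_coe, A,
            Finset.mem_filter] at h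
          simp only [W, Finset.coe_filter, Set.mem_ofPred_eq, Finset.mem_product]
          exact ⟨⟨h.2.1, h.1.1⟩, h.2.2⟩
        · rintro ⟨a, c⟩ - ⟨a', c'⟩ - h
          simp at h
          obtain ⟨rfl, rfl⟩ := h
          rfl
  have himg : W.image (fun x => s(x.1, x.2)) ⊆ G.boosters T := by
    intro e he
    obtain ⟨⟨a, b⟩, hx, rfl⟩ := Finset.mem_image.1 he
    obtain ⟨hxT, l, hl, hlen, ha, hb⟩ := Finset.mem_filter.1 hx
    simp only [Finset.mem_product] at hxT
    have hself : a ≠ b ∧ ¬ G.Adj a b := by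
      by_contra hcon
      have := hG.lt_longestPath le_rfl hl ha hb (by tauto) (by omega)
      omega
    refine mem_boosters.2 ⟨by simpa using hxT, by simpa using hself.1, by simpa using hself.2,
      ?_⟩
    rw [← hlen]
    refine hG.lt_longestPath le_sup_left (hl.mono le_sup_left) ha hb (fun hab => ?_) (by omega)
    simp [hab]
  have hfib : W.card ≤ 2 * (W.image (fun x => s(x.1, x.2))).card := by
    refine Finset.card_le_mul_card_image W 2 fun e he => ?_
    obtain ⟨⟨a, b⟩, hx, rfl⟩ := Finset.mem_image.1 he
    refine (Finset.card_le_card (t := {(a, b), (b, a)}) ?_).trans Finset.card_le_two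
    rintro ⟨c, d⟩ h
    have := (Finset.mem_filter.1 h).2
    simp at this ⊢
    tauto
  have := Finset.card_le_card himg
  omega

/-- If `G₁` is an expander in `T` and `G₁ ⊔ G₂` has no path spanning `T`, then few edges of `G₂` can
be added to `G₁` so that no booster of the resulting graph is an edge of `G₂`. -/
theorem exists_disjoint_boosters {G₁ G₂ : SimpleGraph V} {T : Finset V}
    (hlt : (G₁ ⊔ G₂).longestPath T < T.card) :
    ∃ F ⊆ T.sym2, (F : Set (Sym2 V)) ⊆ G₂.edgeSet ∧ F.card ≤ T.card ∧
      (G₁ ⊔ fromEdgeSet F).longestPath T < T.card ∧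
      Disjoint ((G₁ ⊔ fromEdgeSet F).boosters T : Set (Sym2 V)) G₂.edgeSet := by
  classical
  -- The constraint `|F| ≤ longestPath` survives adding a booster, which raises the right side by at
  -- least one; hence a maximiser leaves no booster in `G₂`.
  let 𝓕 := T.sym2.powerset.filter fun F : Finset (Sym2 V) => (F : Set (Sym2 V)) ⊆ G₂.edgeSet ∧
    F.card ≤ (G₁ ⊔ fromEdgeSet (F : Set (Sym2 V))).longestPath T
  obtain ⟨F, hF, hmax⟩ := Finset.exists_max_image 𝓕
    (fun F : Finset (Sym2 V) => (G₁ ⊔ fromEdgeSet (F : Set (Sym2 V))).longestPath T) ⟨∅, by simp [𝓕]⟩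
  simp only [𝓕, Finset.mem_filter, Finset.mem_powerset] at hF hmax
  obtain ⟨hFT, hFG, hFc⟩ := hF
  have hle : G₁ ⊔ fromEdgeSet (F : Set (Sym2 V)) ≤ G₁ ⊔ G₂ := by
    refine sup_le_sup_left ?_ _
    rw [← G₂.fromEdgeSet_edgeSet]
    exact fromEdgeSet_mono hFG
  refine ⟨F, hFT, hFG, hFc.trans (longestPath_le _ _), ?_, ?_⟩
  · obtain ⟨l, hl, hlen⟩ := (G₁ ⊔ fromEdgeSet (F : Set (Sym2 V))).exists_longestPath T
    have := (hl.mono hle).length_le_longestPath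
    omega
  · rw [Set.disjoint_left]
    intro e he heG
    obtain ⟨heT, hdiag, heF, hlong⟩ := mem_boosters.1 (Finset.mem_coe.1 he)
    have hsup : G₁ ⊔ fromEdgeSet (F : Set (Sym2 V)) ⊔ fromEdgeSet {e} =
        G₁ ⊔ fromEdgeSet ((insert e F : Finset (Sym2 V)) : Set (Sym2 V)) := by
      rw [sup_assoc, ← fromEdgeSet_union, Finset.coe_insert, Set.union_singleton]
    rw [hsup] at hlong
    have := hmax (insert e F) ⟨Finset.insert_subset heT hFT, ?_, ?_⟩
    · omega
    · rw [Finset.coe_insert]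
      exact Set.insert_subset heG hFG
    · have := Finset.card_insert_le e F
      omega

theorem hasHamiltonPath_induce [DecidableEq V] {G : SimpleGraph V} {T : Finset V}
    (hT : T.Nonempty) (h : T.card ≤ G.longestPath T) :
    HasHamiltonPath (G.induce (T : Set V)) := by
  obtain ⟨l, hl, hlen⟩ := G.exists_longestPath T
  have hlT : l.toFinset = T := by
    refine Finset.eq_of_subset_of_card_le (fun v hv => hl.subset v (List.mem_toFinset.1 hv)) ?_
    rw [List.toFinset_card_of_nodup hl.nodup]
    omega
  let l' : List (T : Set V) := l.attachWith (fun v => v ∈ (T : Set V)) hl.subset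
  have hl'map : l'.map Subtype.val = l := List.attachWith_map_subtype_val hl.subset
  have hne : l' ≠ [] := by
    intro h0
    rw [h0] at hl'map
    have := hT.card_pos
    simp [← hl'map] at hlen
    omega
  have hchain : l'.IsChain (G.induce (T : Set V)).Adj := by
    have := hl.isChain
    rw [← hl'map, List.isChain_map] at this
    exact this
  refine ⟨_, _, Walk.ofSupport l' hne hchain, ?_⟩
  refine Walk.IsPath.isHamiltonian_of_mem ?_ ?_
  · rw [Walk.isPath_def, Walk.support_ofSupport]
    refine List.Nodup.of_map Subtype.val ?_
    rw [hl'map]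
    exact hl.nodup
  · rintro ⟨v, hv⟩
    rw [Walk.support_ofSupport]
    have : v ∈ l := by
      rw [← List.mem_toFinset, hlT]
      exact hv
    simpa [l'] using this

end SimpleGraph

/-! ### Sub-pairings that induce expanders. -/

namespace SetPairing

variable {V : Type*} [DecidableEq V]

/-- The sub-pairing with a given set of pairs. -/
def ofSubset (P : SetPairing V) (𝒬 : Finset (Finset V)) (h : 𝒬 ⊆ P.pairing.parts) :
    SetPairing V where
  S := 𝒬.sup id
  pairing := P.pairing.ofSubset h rfl
  card_eq_two e he := P.card_eq_two e (h he)

theorem ofSubset_subset (P : SetPairing V) (𝒬 : Finset (Finset V)) (h : 𝒬 ⊆ P.pairing.parts) :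
    P.ofSubset 𝒬 h ⊆ P :=
  ⟨(Finset.sup_mono h).trans P.pairing.sup_parts.le, h⟩

theorem subset_trans {P Q R : SetPairing V} (h₁ : P ⊆ Q) (h₂ : Q ⊆ R) : P ⊆ R :=
  ⟨h₁.1.trans h₂.1, h₁.2.trans h₂.2⟩

theorem card_eq (P : SetPairing V) : P.S.card = 2 * P.pairing.parts.card := by
  rw [← P.pairing.sum_card_parts, Finset.sum_congr rfl P.card_eq_two]
  simp [mul_comm]

theorem exists_subset_card (P : SetPairing V) {m : ℕ} (hm : 2 * m ≤ P.S.card) :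
    ∃ Q : SetPairing V, Q ⊆ P ∧ Q.S.card = 2 * m := by
  obtain ⟨𝒬, h𝒬, hc⟩ := Finset.exists_subset_card_eq (s := P.pairing.parts) (n := m)
    (by have := P.card_eq; omega)
  exact ⟨P.ofSubset 𝒬 h𝒬, P.ofSubset_subset 𝒬 h𝒬, by rw [card_eq, ← hc]; rfl⟩

/-- The pairs that avoid `U`. -/
def avoiding (P : SetPairing V) (U : Finset V) : SetPairing V :=
  P.ofSubset (P.pairing.parts.filter fun e => Disjoint e U) (Finset.filter_subset _ _)

theorem mem_avoiding {P : SetPairing V} {U : Finset V} {v : V} :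
    v ∈ (P.avoiding U).S ↔ ∃ e ∈ P.pairing.parts, Disjoint e U ∧ v ∈ e := by
  simp [avoiding, ofSubset, Finset.mem_sup, and_assoc]

/-- Each vertex of `U` spoils at most one pair, that is two vertices. -/
theorem card_le_card_avoiding (P : SetPairing V) (U : Finset V) :
    P.S.card ≤ (P.avoiding U).S.card + 2 * U.card := by
  have h1 : (P.pairing.parts.filter fun e => ¬ Disjoint e U).card ≤ U.card := by
    refine Finset.card_le_card_of_forall_subsingleton (fun e u => u ∈ e) ?_ ?_
    · intro e he
      obtain ⟨u, hue, huU⟩ := Finset.not_disjoint_iff.1 (Finset.mem_filter.1 he).2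
      exact ⟨u, huU, hue⟩
    · rintro u - e ⟨he, hue⟩ e' ⟨he', hue'⟩
      exact P.pairing.eq_of_mem_parts (Finset.mem_filter.1 he).1 (Finset.mem_filter.1 he').1
        hue hue'
  have h2 := Finset.card_filter_add_card_filter_not (s := P.pairing.parts)
    (fun e => Disjoint e U)
  have h3 : (P.avoiding U).pairing.parts = P.pairing.parts.filter fun e => Disjoint e U := rfl
  rw [card_eq, card_eq, h3]
  omega

theorem avoiding_anti (P : SetPairing V) {U U' : Finset V} (h : U ⊆ U') :
    (P.avoiding U').S ⊆ (P.avoiding U).S := by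
  intro v hv
  rw [mem_avoiding] at hv ⊢
  obtain ⟨e, he, hd, hv⟩ := hv
  exact ⟨e, he, hd.mono_right h, hv⟩

theorem notMem_of_mem_avoiding {P : SetPairing V} {U : Finset V} {v : V}
    (hv : v ∈ (P.avoiding U).S) : v ∉ U := by
  obtain ⟨e, -, hd, hv⟩ := mem_avoiding.1 hv
  exact Finset.disjoint_left.1 hd hv

/-- In a joined graph, every large pairing contains a pairing whose vertex set induces an
expander. -/
theorem exists_isExpander {G : SimpleGraph V} {k : ℕ} (hk : 0 < k) (hG : G.Joined k)
    (P : SetPairing V) (hP : 11 * k ≤ P.S.card) :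
    ∃ Q : SetPairing V, Q ⊆ P ∧ Q.S.Nonempty ∧ G.IsExpander Q.S k := by
  classical
  let 𝓤 := P.S.powerset.filter fun U => U.card ≤ k ∧
    (G.outerNeighbors (P.avoiding U).S U).card ≤ 3 * U.card
  obtain ⟨U, hU, hmax⟩ := Finset.exists_max_image 𝓤 Finset.card
    ⟨∅, Finset.mem_filter.2 ⟨by simp, by simp, by simp [SimpleGraph.outerNeighbors]⟩⟩
  simp only [𝓤, Finset.mem_filter, Finset.mem_powerset] at hU hmax
  obtain ⟨hUS, hUk, hUN⟩ := hU
  have hsub : P.avoiding U ⊆ P := P.ofSubset_subset _ _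
  have hcard := P.card_le_card_avoiding U
  refine ⟨P.avoiding U, hsub, Finset.card_pos.1 (by omega), hG, ?_⟩
  intro U' hU' hne hU'k
  by_contra hcon
  push Not at hcon
  have hdisj : Disjoint U U' := Finset.disjoint_right.2 fun v hv => notMem_of_mem_avoiding (hU' hv)
  have hunion := Finset.card_union_of_disjoint hdisj
  -- Poor expansion passes to the union, because enlarging the deleted set only shrinks the
  -- remaining vertices. So maximality of `U` forces `|U ∪ U'| > k`.
  have hN : (G.outerNeighbors (P.avoiding (U ∪ U')).S (U ∪ U')).card ≤ 3 * (U ∪ U').card := by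
    have : G.outerNeighbors (P.avoiding (U ∪ U')).S (U ∪ U') ⊆
        G.outerNeighbors (P.avoiding U).S U ∪ G.outerNeighbors (P.avoiding U).S U' := by
      intro v hv
      simp only [SimpleGraph.mem_outerNeighbors, Finset.mem_union] at hv ⊢
      have hv' := P.avoiding_anti (Finset.subset_union_left (s₁ := U) (s₂ := U')) hv.1.1
      obtain ⟨u, hu | hu, huv⟩ := hv.2
      · exact .inl ⟨⟨hv', by tauto⟩, u, hu, huv⟩
      · exact .inr ⟨⟨hv', by tauto⟩, u, hu, huv⟩
    have := (Finset.card_le_card this).trans (Finset.card_union_le _ _)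
    omega
  have hbig : k < (U ∪ U').card := by
    by_contra hle
    have := hmax (U ∪ U') ⟨Finset.union_subset hUS (hU'.trans hsub.1), by omega, hN⟩
    have := hne.card_pos
    omega
  have hcard' := P.card_le_card_avoiding (U ∪ U')
  have hY := Finset.le_card_sdiff (G.outerNeighbors (P.avoiding (U ∪ U')).S (U ∪ U'))
    (P.avoiding (U ∪ U')).S
  -- As `|U ∪ U'| ≤ 2k`, deleting its pairs costs at most `4k` vertices and its neighbours at most
  -- `6k`; of `11k` at least `k` remain, with no edge to `U ∪ U'`.
  obtain ⟨x, hx, y, hy, hxy⟩ := hG (U ∪ U')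
    ((P.avoiding (U ∪ U')).S \ G.outerNeighbors (P.avoiding (U ∪ U')).S (U ∪ U'))
    (Finset.disjoint_right.2 fun v hv => notMem_of_mem_avoiding (Finset.mem_sdiff.1 hv).1)
    hbig.le (by omega)
  obtain ⟨hy1, hy2⟩ := Finset.mem_sdiff.1 hy
  exact hy2 (SimpleGraph.mem_outerNeighbors.2 ⟨⟨hy1, notMem_of_mem_avoiding hy1⟩, x, hx, hxy⟩)

end SetPairing

/-! ### Random subsets as finite weighted sums. -/

section BernoulliSum

variable {α : Type*}

open Classical in
/-- The indicator function of a predicate on finite sets. -/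
noncomputable def indicatorOf (Q : Finset α → Prop) (A : Finset α) : ℝ := if Q A then 1 else 0

theorem indicatorOf_nonneg (Q : Finset α → Prop) (A : Finset α) : 0 ≤ indicatorOf Q A := by
  unfold indicatorOf
  split_ifs <;> norm_num

theorem indicatorOf_le_sum {ι : Type*} (s : Finset ι) {Q : Finset α → Prop}
    {R : ι → Finset α → Prop} {A : Finset α} (h : Q A → ∃ i ∈ s, R i A) :
    indicatorOf Q A ≤ ∑ i ∈ s, indicatorOf (R i) A := by
  by_cases hQ : Q A
  · obtain ⟨i, hi, hR⟩ := h hQ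
    calc indicatorOf Q A = indicatorOf (R i) A := by simp [indicatorOf, hQ, hR]
      _ ≤ _ := Finset.single_le_sum (f := fun i => indicatorOf (R i) A)
        (fun i _ => indicatorOf_nonneg _ _) hi
  · simp only [indicatorOf, hQ, if_false]
    exact Finset.sum_nonneg fun i _ => indicatorOf_nonneg _ _

variable [DecidableEq α]

/-- The expectation of `f A` for a random subset `A` of `U` that contains each element
independently with probability `p`. -/
def bernoulliSum (U : Finset α) (p : ℝ) (f : Finset α → ℝ) : ℝ :=
  ∑ A ∈ U.powerset, p ^ A.card * (1 - p) ^ (U \ A).card * f A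

theorem bernoulliSum_add (U : Finset α) (p : ℝ) (f g : Finset α → ℝ) :
    bernoulliSum U p (fun A => f A + g A) = bernoulliSum U p f + bernoulliSum U p g := by
  simp [bernoulliSum, mul_add, Finset.sum_add_distrib]

theorem bernoulliSum_const_mul (U : Finset α) (p c : ℝ) (f : Finset α → ℝ) :
    bernoulliSum U p (fun A => c * f A) = c * bernoulliSum U p f := by
  simp only [bernoulliSum, Finset.mul_sum]
  exact Finset.sum_congr rfl fun _ _ => by ring

theorem bernoulliSum_sum {ι : Type*} (U : Finset α) (p : ℝ) (s : Finset ι)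
    (f : ι → Finset α → ℝ) :
    bernoulliSum U p (fun A => ∑ i ∈ s, f i A) = ∑ i ∈ s, bernoulliSum U p (f i) := by
  simp only [bernoulliSum, Finset.mul_sum]
  exact Finset.sum_comm

theorem bernoulliSum_const (U : Finset α) (p c : ℝ) : bernoulliSum U p (fun _ => c) = c := by
  have h : ∑ A ∈ U.powerset, p ^ A.card * (1 - p) ^ (U \ A).card = 1 := by
    have h1 := Finset.sum_pow_mul_eq_add_pow p (1 - p) U
    rw [add_sub_cancel, one_pow] at h1
    refine (Finset.sum_congr rfl fun A hA => ?_).trans h1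
    rw [Finset.card_sdiff_of_subset (Finset.mem_powerset.1 hA)]
  rw [bernoulliSum, ← Finset.sum_mul, h, one_mul]

theorem bernoulliSum_mono {U : Finset α} {p : ℝ} (hp₀ : 0 ≤ p) (hp₁ : p ≤ 1)
    {f g : Finset α → ℝ} (h : ∀ A ⊆ U, f A ≤ g A) : bernoulliSum U p f ≤ bernoulliSum U p g := by
  refine Finset.sum_le_sum fun A hA => mul_le_mul_of_nonneg_left (h A (Finset.mem_powerset.1 hA)) ?_
  have := sub_nonneg.2 hp₁
  positivity

theorem bernoulliSum_congr {U : Finset α} {p : ℝ}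
    {f g : Finset α → ℝ} (h : ∀ A ⊆ U, f A = g A) : bernoulliSum U p f = bernoulliSum U p g :=
  Finset.sum_congr rfl fun A hA => by rw [h A (Finset.mem_powerset.1 hA)]

/-- Conditioning on whether `a` is chosen. -/
theorem bernoulliSum_insert {U : Finset α} {a : α} (ha : a ∉ U) (p : ℝ) (f : Finset α → ℝ) :
    bernoulliSum (insert a U) p f =
      (1 - p) * bernoulliSum U p f + p * bernoulliSum U p fun A => f (insert a A) := by
  rw [bernoulliSum, Finset.sum_powerset_insert ha, bernoulliSum, bernoulliSum, Finset.mul_sum,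
    Finset.mul_sum]
  congr 1 <;> refine Finset.sum_congr rfl fun A hA => ?_
  · have haA : a ∉ A := fun h => ha (Finset.mem_powerset.1 hA h)
    rw [Finset.insert_sdiff_of_notMem _ haA,
      Finset.card_insert_of_notMem fun h => ha (Finset.mem_sdiff.1 h).1]
    ring
  · have haA : a ∉ A := fun h => ha (Finset.mem_powerset.1 hA h)
    rw [Finset.insert_sdiff_insert, Finset.sdiff_insert_of_notMem ha,
      Finset.card_insert_of_notMem haA]
    ring

/-- Two-round exposure: the union of two independent `q`-random subsets is `p`-random for
`1 - p = (1 - q) ^ 2`. -/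
theorem bernoulliSum_union (U : Finset α) (q : ℝ) (f : Finset α → ℝ) :
    bernoulliSum U (1 - (1 - q) ^ 2) f =
      bernoulliSum U q fun A => bernoulliSum U q fun B => f (A ∪ B) := by
  induction U using Finset.induction_on generalizing f with
  | empty => simp [bernoulliSum]
  | insert a U ha ih =>
    simp only [bernoulliSum_insert ha, ih, bernoulliSum_add, bernoulliSum_const_mul,
      Finset.insert_union, Finset.union_insert, Finset.insert_idem]
    ring

theorem bernoulliSum_subset_disjoint {U F W : Finset α} (hF : F ⊆ U) (hW : W ⊆ U)
    (hFW : Disjoint F W) (q : ℝ) :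
    bernoulliSum U q (indicatorOf fun B => F ⊆ B ∧ Disjoint W B) =
      q ^ F.card * (1 - q) ^ W.card := by
  -- Zeroing the "chosen" factor on `W` and the "not chosen" factor on `F` kills exactly the terms
  -- `A` that violate the event.
  have h := Finset.prod_add (fun i => if i ∈ W then 0 else q) (fun i => if i ∈ F then 0 else 1 - q) U
  have h1 : ∏ i ∈ U, ((if i ∈ W then 0 else q) + (if i ∈ F then 0 else 1 - q)) =
      q ^ F.card * (1 - q) ^ W.card := by
    calc _ = ∏ i ∈ U, (if i ∈ F then q else 1) * (if i ∈ W then 1 - q else 1) := by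
          refine Finset.prod_congr rfl fun i _ => ?_
          by_cases h1 : i ∈ F
          · simp [h1, Finset.disjoint_left.1 hFW h1]
          · by_cases h2 : i ∈ W <;> simp [h1, h2]
      _ = _ := by
          rw [Finset.prod_mul_distrib, Finset.prod_ite_mem, Finset.prod_ite_mem,
            Finset.inter_eq_right.2 hF, Finset.inter_eq_right.2 hW, Finset.prod_const,
            Finset.prod_const]
  rw [← h1, h]
  refine Finset.sum_congr rfl fun A hA => ?_
  have hAU := Finset.mem_powerset.1 hA
  unfold indicatorOf
  split_ifs with hc
  · have e1 : ∏ i ∈ A, (if i ∈ W then 0 else q) = q ^ A.card := by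
      rw [← Finset.prod_const]
      exact Finset.prod_congr rfl fun i hi => if_neg (Finset.disjoint_right.1 hc.2 hi)
    have e2 : ∏ i ∈ U \ A, (if i ∈ F then 0 else 1 - q) = (1 - q) ^ (U \ A).card := by
      rw [← Finset.prod_const]
      exact Finset.prod_congr rfl fun i hi => if_neg fun h => (Finset.mem_sdiff.1 hi).2 (hc.1 h)
    rw [e1, e2, mul_one]
  · rw [mul_zero, eq_comm, mul_eq_zero]
    rw [not_and_or, Finset.not_subset, Finset.not_disjoint_iff] at hc
    obtain ⟨i, hiF, hiA⟩ | ⟨i, hiW, hiA⟩ := hc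
    · exact .inr (Finset.prod_eq_zero (Finset.mem_sdiff.2 ⟨hF hiF, hiA⟩) (if_pos hiF))
    · exact .inl (Finset.prod_eq_zero hiA (if_pos hiW))

end BernoulliSum

/-! ### Union bounds in the two-round random graph. -/

namespace SimpleGraph

variable {V : Type*}

/-- Since `|F| ≤ |T|` and `c ≥ 1`, each term is at most `c^|T| (q/c)^|F|`; the size restriction can
then be dropped and the binomial theorem used. -/
theorem sum_pow_card_sym2_le {T : Finset V} (hT : T.Nonempty) {q c  : ℝ} (hq : 0 ≤ q) (hc : 1 ≤ c) :
    ∑ F ∈ T.sym2.powerset.filter (fun F => F.card ≤ T.card), q ^ F.card ≤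
      c ^ T.card * Real.exp (q * T.card ^ 2 / c) := by
  classical
  have hc0 : 0 < c := by linarith
  calc _ ≤ ∑ F ∈ T.sym2.powerset.filter (fun F => F.card ≤ T.card),
          c ^ T.card * (q / c) ^ F.card := by
        refine Finset.sum_le_sum fun F hF => ?_
        rw [div_pow, mul_div_assoc', le_div_iff₀ (by positivity), mul_comm]
        exact mul_le_mul_of_nonneg_right (pow_le_pow_right₀ hc (Finset.mem_filter.1 hF).2)
          (by positivity)
    _ ≤ ∑ F ∈ T.sym2.powerset, c ^ T.card * (q / c) ^ F.card :=
        Finset.sum_le_sum_of_subset_of_nonneg (Finset.filter_subset _ _)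
          fun _ _ _ => by positivity
    _ = c ^ T.card * (q / c + 1) ^ T.sym2.card := by
        rw [← Finset.mul_sum, ← Finset.sum_pow_mul_eq_add_pow]
        simp
    _ ≤ c ^ T.card * Real.exp (q / c) ^ T.sym2.card := by
        gcongr
        exact Real.add_one_le_exp _
    _ ≤ _ := by
        rw [← Real.exp_nat_mul]
        gcongr
        have h : T.sym2.card ≤ T.card ^ 2 := by
          rw [Finset.card_sym2, Nat.choose_two_right]
          have := hT.card_pos
          refine Nat.div_le_of_le_mul ?_
          simp
          nlinarith
        have h' : (T.sym2.card : ℝ) ≤ (T.card : ℝ) ^ 2 := by exact_mod_cast h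
        calc (T.sym2.card : ℝ) * (q / c) ≤ (T.card : ℝ) ^ 2 * (q / c) := by gcongr
          _ = _ := by ring

/-- The pair `(G₁, G₂)` is bad if `G₁` is not joined, or if some set `T` of at most `t` vertices
induces an expander in `G₁` but `G₁ ⊔ G₂` has no path spanning `T`. -/
def IsBadPair (G₁ G₂ : SimpleGraph V) (k t : ℕ) : Prop :=
  ¬ G₁.Joined k ∨ ∃ T : Finset V, T.Nonempty ∧ T.card ≤ t ∧ G₁.IsExpander T k ∧
    (G₁ ⊔ G₂).longestPath T < T.card

variable [DecidableEq V]

/-- Every large set-pairing contains a nonempty one whose vertex set has a Hamilton path. -/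
def HasHamiltonSubpairings (G : SimpleGraph V) (s : ℝ) : Prop :=
  ∀ P : SetPairing V, s ≤ (P.S.card : ℝ) →
    ∃ Q : SetPairing V, Q ⊆ P ∧ Q.S.Nonempty ∧ HasHamiltonPath (G.induce (Q.S : Set V))

theorem hasHamiltonSubpairings_of_not_isBadPair {G₁ G₂ : SimpleGraph V} {k m : ℕ} {s : ℝ}
    (hk : 0 < k) (hkm : 11 * k ≤ 2 * m)
    (hms : 2 * (m : ℝ) < s + 2) (h : ¬ IsBadPair G₁ G₂ k (2 * m)) :
    (G₁ ⊔ G₂).HasHamiltonSubpairings s := by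
  intro P hP
  unfold IsBadPair at h
  push Not at h
  obtain ⟨hJ, h⟩ := h
  -- Parity: an even number exceeding `2m - 2` is at least `2m`.
  have hPm : 2 * m ≤ P.S.card := by
    have h1 : (P.S.card : ℝ) = 2 * P.pairing.parts.card := by exact_mod_cast P.card_eq
    have h2 : (m : ℝ) < P.pairing.parts.card + 1 := by linarith
    have h3 : m < P.pairing.parts.card + 1 := by exact_mod_cast h2
    have := P.card_eq
    omega
  obtain ⟨P', hP', hc⟩ := P.exists_subset_card hPm
  obtain ⟨Q, hQ, hne, hexp⟩ := P'.exists_isExpander hk hJ (by omega)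
  refine ⟨Q, SetPairing.subset_trans hQ hP', hne, hasHamiltonPath_induce hne ?_⟩
  exact h Q.S hne (hc ▸ Finset.card_le_card hQ.1) hexp

variable [Fintype V]

theorem edgeSet_fromEdgeSet_of_subset {A : Finset (Sym2 V)}
    (hA : A ⊆ (⊤ : SimpleGraph V).edgeFinset) :
    (fromEdgeSet (A : Set (Sym2 V))).edgeSet = A := by
  rw [edgeSet_fromEdgeSet, sdiff_eq_left, Set.disjoint_left]
  intro e he
  simpa using hA he

/-- There are finitely many graphs, each determined by its edge set, so the measure is a sum of
point masses. -/
theorem binomialRandom_real_eq_bernoulliSum (p : I) (Q : SimpleGraph V → Prop) :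
    (binomialRandom V p).real {G | Q G} =
      bernoulliSum (⊤ : SimpleGraph V).edgeFinset p
        (indicatorOf fun A => Q (fromEdgeSet (A : Set (Sym2 V)))) := by
  classical
  have : MeasurableSingletonClass (SimpleGraph V) := ⟨fun G => by
    have h : ({G} : Set (SimpleGraph V)) = edgeSet ⁻¹' {G.edgeSet} := by
      ext H
      simp
    rw [h]
    exact measurable_edgeSet (measurableSet_singleton _)⟩
  have h0 : (binomialRandom V p).real {G | Q G} =
      ∑ G : SimpleGraph V, if Q G then (binomialRandom V p).real {G} else 0 := by
    rw [← Finset.sum_filter, sum_measureReal_singleton]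
    congr 1
    ext G
    simp
  rw [h0, bernoulliSum]
  refine Finset.sum_bij (fun G _ => G.edgeFinset) (fun G _ => ?_) (fun G _ H _ h => ?_)
    (fun A hA => ?_) (fun G _ => ?_)
  · exact Finset.mem_powerset.2 (edgeFinset_mono le_top)
  · exact edgeFinset_inj.1 h
  · refine ⟨fromEdgeSet (A : Set (Sym2 V)), Finset.mem_univ _, ?_⟩
    rw [← Finset.coe_inj, coe_edgeFinset]
    exact edgeSet_fromEdgeSet_of_subset (Finset.mem_powerset.1 hA)
  · have hsub : G.edgeFinset ⊆ (⊤ : SimpleGraph V).edgeFinset := edgeFinset_mono le_top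
    have hc : (⊤ : SimpleGraph V).edgeFinset.card = (Nat.card V).choose 2 := by
      rw [card_edgeFinset_top_eq_card_choose_two, Nat.card_eq_fintype_card]
    have hn : G.edgeSet.ncard = G.edgeFinset.card := by
      rw [← coe_edgeFinset, Set.ncard_coe_finset]
    simp only [indicatorOf, coe_edgeFinset, fromEdgeSet_edgeSet]
    rw [Finset.card_sdiff_of_subset hsub, hc]
    split_ifs
    · rw [measureReal_def, binomialRandom_singleton, hn]
      simp
    · simp

/-- Failure is witnessed by two disjoint sets of size exactly `k`, at most `4^n` choices, between
which all `k²` edges are absent. -/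
theorem bernoulliSum_not_joined_le {q : ℝ} (hq₀ : 0 ≤ q) (hq₁ : q ≤ 1) (k : ℕ) :
    bernoulliSum (⊤ : SimpleGraph V).edgeFinset q
      (indicatorOf fun A => ¬ (fromEdgeSet (A : Set (Sym2 V))).Joined k) ≤
      4 ^ Fintype.card V * (1 - q) ^ (k ^ 2) := by
  classical
  let 𝒳 : Finset (Finset V × Finset V) := Finset.univ.filter fun x =>
    Disjoint x.1 x.2 ∧ x.1.card = k ∧ x.2.card = k
  let W : Finset V × Finset V → Finset (Sym2 V) := fun x =>
    (x.1 ×ˢ x.2).image fun y => s(y.1, y.2)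
  have hW : ∀ x ∈ 𝒳, W x ⊆ (⊤ : SimpleGraph V).edgeFinset ∧ (W x).card = k ^ 2 := by
    rintro ⟨X, Y⟩ hx
    obtain ⟨hd, hX, hY⟩ := (Finset.mem_filter.1 hx).2
    refine ⟨?_, ?_⟩
    · intro e he
      obtain ⟨⟨a, b⟩, hab, rfl⟩ := Finset.mem_image.1 he
      obtain ⟨ha, hb⟩ := Finset.mem_product.1 hab
      rw [mem_edgeFinset, mem_edgeSet, top_adj]
      rintro h
      obtain rfl : a = b := h
      exact Finset.disjoint_left.1 hd ha hb
    · rw [Finset.card_image_of_injOn, Finset.card_product, sq]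
      · exact congrArg₂ _ hX hY
      · rintro ⟨a, b⟩ hab ⟨c, d⟩ hcd h
        simp only [Finset.coe_product, Set.mem_prod, Finset.mem_coe] at hab hcd
        rcases Sym2.eq_iff.1 h with ⟨rfl, rfl⟩ | ⟨rfl, rfl⟩
        · rfl
        · exact absurd hcd.2 (Finset.disjoint_left.1 hd hab.1)
  calc _ ≤ bernoulliSum (⊤ : SimpleGraph V).edgeFinset q
        (fun A => ∑ x ∈ 𝒳, indicatorOf (fun A => ∅ ⊆ A ∧ Disjoint (W x) A) A) := by
        refine bernoulliSum_mono hq₀ hq₁ fun A hA => indicatorOf_le_sum _ fun h => ?_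
        unfold Joined at h
        push Not at h
        obtain ⟨X, Y, hXY, hX, hY, h⟩ := h
        obtain ⟨X', hX', hcX⟩ := Finset.exists_subset_card_eq hX
        obtain ⟨Y', hY', hcY⟩ := Finset.exists_subset_card_eq hY
        refine ⟨(X', Y'), Finset.mem_filter.2 ⟨Finset.mem_univ _,
          Finset.disjoint_of_subset_left hX' (Finset.disjoint_of_subset_right hY' hXY), hcX, hcY⟩,
          Finset.empty_subset _, ?_⟩
        rw [Finset.disjoint_left]
        intro e he heA
        obtain ⟨⟨a, b⟩, hab, rfl⟩ := Finset.mem_image.1 he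
        obtain ⟨ha, hb⟩ := Finset.mem_product.1 hab
        refine h a (hX' ha) b (hY' hb) ?_
        rw [← mem_edgeSet, edgeSet_fromEdgeSet_of_subset hA]
        exact heA
    _ = ∑ x ∈ 𝒳, (1 - q) ^ (k ^ 2) := by
        rw [bernoulliSum_sum]
        refine Finset.sum_congr rfl fun x hx => ?_
        rw [bernoulliSum_subset_disjoint (Finset.empty_subset _) (hW x hx).1
          (Finset.disjoint_empty_left _), (hW x hx).2]
        simp
    _ ≤ _ := by
        rw [Finset.sum_const, nsmul_eq_mul]
        have h1 := sub_nonneg.2 hq₁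
        refine mul_le_mul_of_nonneg_right ?_ (by positivity)
        have h2 : 𝒳.card ≤ 4 ^ Fintype.card V := by
          refine (Finset.card_le_univ _).trans ?_
          rw [Fintype.card_prod, Fintype.card_finset, ← mul_pow]
          norm_num
        exact_mod_cast h2

/-- An expander is unlikely to have no spanning path after adding random edges. -/
theorem bernoulliSum_longestPath_lt_le {q c : ℝ} (hq₀ : 0 ≤ q) (hq₁ : q ≤ 1) (hc : 1 ≤ c)
    {G : SimpleGraph V} {T : Finset V} {k : ℕ} (hG : G.IsExpander T k) (hT : T.Nonempty) :
    bernoulliSum (⊤ : SimpleGraph V).edgeFinset q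
      (indicatorOf fun B => (G ⊔ fromEdgeSet (B : Set (Sym2 V))).longestPath T < T.card) ≤
      Real.exp (-(q * k ^ 2 / 2)) * (c ^ T.card * Real.exp (q * T.card ^ 2 / c)) := by
  classical
  let W : Finset (Sym2 V) → Finset (Sym2 V) := fun F =>
    (G ⊔ fromEdgeSet (F : Set (Sym2 V))).boosters T
  let 𝓕 := (T.sym2.powerset.filter fun F => F.card ≤ T.card).filter fun F =>
    F ⊆ (⊤ : SimpleGraph V).edgeFinset ∧
      (G ⊔ fromEdgeSet (F : Set (Sym2 V))).longestPath T < T.card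
  calc _ ≤ bernoulliSum (⊤ : SimpleGraph V).edgeFinset q
        (fun B => ∑ F ∈ 𝓕, indicatorOf (fun B => F ⊆ B ∧ Disjoint (W F) B) B) := by
        refine bernoulliSum_mono hq₀ hq₁ fun B hB => indicatorOf_le_sum _ fun h => ?_
        obtain ⟨F, hFT, hFB, hFc, hlt, hd⟩ := exists_disjoint_boosters h
        rw [edgeSet_fromEdgeSet_of_subset hB] at hFB hd
        rw [Finset.coe_subset] at hFB
        exact ⟨F, Finset.mem_filter.2 ⟨Finset.mem_filter.2 ⟨Finset.mem_powerset.2 hFT, hFc⟩,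
          hFB.trans hB, hlt⟩, hFB, Finset.disjoint_coe.1 hd⟩
    _ = ∑ F ∈ 𝓕, q ^ F.card * (1 - q) ^ (W F).card := by
        rw [bernoulliSum_sum]
        refine Finset.sum_congr rfl fun F hF => ?_
        obtain ⟨-, hFU, -⟩ := Finset.mem_filter.1 hF
        refine bernoulliSum_subset_disjoint hFU (fun e he => ?_) ?_ q
        · simpa using (mem_boosters.1 he).2.1
        -- Boosters are non-edges of `G + F`, so requiring `F` and forbidding boosters concern
        -- disjoint sets of pairs.
        · refine Finset.disjoint_left.2 fun e heF heW => (mem_boosters.1 heW).2.2.1 ?_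
          have hdiag := (mem_boosters.1 heW).2.1
          rw [edgeSet_sup, edgeSet_fromEdgeSet]
          exact .inr ⟨heF, by simpa using hdiag⟩
    _ ≤ ∑ F ∈ 𝓕, q ^ F.card * Real.exp (-(q * k ^ 2 / 2)) := by
        refine Finset.sum_le_sum fun F hF => mul_le_mul_of_nonneg_left ?_ (by positivity)
        obtain ⟨-, -, hlt⟩ := Finset.mem_filter.1 hF
        have hb : ((k : ℝ)) ^ 2 ≤ 2 * (W F).card := by
          exact_mod_cast (hG.mono le_sup_left).sq_le_card_boosters hT hlt
        calc (1 - q) ^ (W F).card ≤ Real.exp (-q) ^ (W F).card :=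
              pow_le_pow_left₀ (sub_nonneg.2 hq₁) (Real.one_sub_le_exp_neg q) _
          _ = Real.exp (-((W F).card * q)) := by rw [← Real.exp_nat_mul, mul_neg]
          _ ≤ _ := by
              gcongr
              nlinarith
    _ ≤ ∑ F ∈ T.sym2.powerset.filter (fun F => F.card ≤ T.card),
          q ^ F.card * Real.exp (-(q * k ^ 2 / 2)) :=
        Finset.sum_le_sum_of_subset_of_nonneg (Finset.filter_subset _ _)
          fun _ _ _ => by positivity
    _ ≤ _ := by
        rw [← Finset.sum_mul, mul_comm]
        gcongr
        exact sum_pow_card_sym2_le hT hq₀ hc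

theorem bernoulliSum_exists_longestPath_lt_le {q c : ℝ} (hq₀ : 0 ≤ q) (hq₁ : q ≤ 1) (hc : 1 ≤ c)
    (G : SimpleGraph V) (k t : ℕ) :
    bernoulliSum (⊤ : SimpleGraph V).edgeFinset q (indicatorOf fun B =>
      ∃ T : Finset V, T.Nonempty ∧ T.card ≤ t ∧ G.IsExpander T k ∧
        (G ⊔ fromEdgeSet (B : Set (Sym2 V))).longestPath T < T.card) ≤
      2 ^ Fintype.card V * (Real.exp (-(q * k ^ 2 / 2)) * (c ^ t * Real.exp (q * t ^ 2 / c))) := by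
  classical
  let 𝒯 := (Finset.univ : Finset (Finset V)).filter fun T => T.Nonempty ∧ T.card ≤ t ∧
    G.IsExpander T k
  calc _ ≤ bernoulliSum (⊤ : SimpleGraph V).edgeFinset q (fun B => ∑ T ∈ 𝒯,
        indicatorOf (fun B => (G ⊔ fromEdgeSet (B : Set (Sym2 V))).longestPath T < T.card) B) := by
        refine bernoulliSum_mono hq₀ hq₁ fun B hB => indicatorOf_le_sum _ ?_
        rintro ⟨T, h1, h2, h3, h4⟩
        exact ⟨T, Finset.mem_filter.2 ⟨Finset.mem_univ _, h1, h2, h3⟩, h4⟩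
    _ ≤ ∑ T ∈ 𝒯, Real.exp (-(q * k ^ 2 / 2)) * (c ^ t * Real.exp (q * t ^ 2 / c)) := by
        rw [bernoulliSum_sum]
        refine Finset.sum_le_sum fun T hT => ?_
        obtain ⟨-, hne, hTt, hexp⟩ := Finset.mem_filter.1 hT
        refine (bernoulliSum_longestPath_lt_le hq₀ hq₁ hc hexp hne).trans ?_
        have : (T.card : ℝ) ≤ t := by exact_mod_cast hTt
        gcongr
    _ ≤ _ := by
        rw [Finset.sum_const, nsmul_eq_mul]
        refine mul_le_mul_of_nonneg_right ?_ (by positivity)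
        have := Finset.card_le_univ 𝒯
        rw [Fintype.card_finset] at this
        exact_mod_cast this

/-- The second-round bound is uniform in the first-round graph, so it can be averaged over `A` as a
constant. -/
theorem bernoulliSum_isBadPair_le {q c : ℝ} (hq₀ : 0 ≤ q) (hq₁ : q ≤ 1) (hc : 1 ≤ c) (k t : ℕ) :
    (bernoulliSum (⊤ : SimpleGraph V).edgeFinset q fun A =>
      bernoulliSum (⊤ : SimpleGraph V).edgeFinset q (indicatorOf fun B =>
        IsBadPair (fromEdgeSet (A : Set (Sym2 V))) (fromEdgeSet (B : Set (Sym2 V))) k t)) ≤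
      4 ^ Fintype.card V * Real.exp (-(q * k ^ 2)) + 2 ^ Fintype.card V *
        (Real.exp (-(q * k ^ 2 / 2)) * (c ^ t * Real.exp (q * t ^ 2 / c))) := by
  refine (bernoulliSum_mono hq₀ hq₁ (g := fun A =>
    indicatorOf (fun A => ¬ (fromEdgeSet (A : Set (Sym2 V))).Joined k) A +
      2 ^ Fintype.card V * (Real.exp (-(q * k ^ 2 / 2)) * (c ^ t * Real.exp (q * t ^ 2 / c))))
      fun A hA => ?_).trans ?_
  · refine le_trans ?_ (add_le_add_right
      (bernoulliSum_exists_longestPath_lt_le hq₀ hq₁ hc (fromEdgeSet (A : Set (Sym2 V))) k t) _)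
    rw [← bernoulliSum_const (⊤ : SimpleGraph V).edgeFinset q (indicatorOf _ A),
      ← bernoulliSum_add]
    refine bernoulliSum_mono hq₀ hq₁ fun B _ => ?_
    unfold indicatorOf IsBadPair
    split_ifs <;> first | (norm_num; done) | (rename_i h1 h2 h3; exact (h1.elim h2 h3).elim)
  · rw [bernoulliSum_add, bernoulliSum_const]
    refine add_le_add_left ((bernoulliSum_not_joined_le hq₀ hq₁ k).trans ?_) _
    gcongr
    calc (1 - q) ^ (k ^ 2) ≤ Real.exp (-q) ^ (k ^ 2) :=
          pow_le_pow_left₀ (sub_nonneg.2 hq₁) (Real.one_sub_le_exp_neg q) _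
      _ = _ := by
          rw [← Real.exp_nat_mul]
          push_cast
          ring_nf

/-- Two-round exposure bound for the failure probability in the binomial random graph. -/
theorem binomialRandom_real_not_hasHamiltonSubpairings_le (p : I) {q c s : ℝ} (hq₀ : 0 ≤ q)
    (hq₁ : q ≤ 1) (hpq : (p : ℝ) = 1 - (1 - q) ^ 2) (hc : 1 ≤ c) {k m : ℕ} (hk : 0 < k)
    (hkm : 11 * k ≤ 2 * m) (hms : 2 * (m : ℝ) < s + 2) :
    (binomialRandom V p).real {G | ¬ G.HasHamiltonSubpairings s} ≤
      4 ^ Fintype.card V * Real.exp (-(q * k ^ 2)) + 2 ^ Fintype.card V *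
        (Real.exp (-(q * k ^ 2 / 2)) *
          (c ^ (2 * m) * Real.exp (q * ((2 * m : ℕ) : ℝ) ^ 2 / c))) := by
  rw [binomialRandom_real_eq_bernoulliSum, hpq, bernoulliSum_union]
  refine le_trans ?_ (bernoulliSum_isBadPair_le hq₀ hq₁ hc k (2 * m))
  refine bernoulliSum_mono hq₀ hq₁ fun A _ => bernoulliSum_mono hq₀ hq₁ fun B _ => ?_
  by_cases h : IsBadPair (fromEdgeSet (A : Set (Sym2 V))) (fromEdgeSet (B : Set (Sym2 V))) k (2 * m)
  · unfold indicatorOf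
    split_ifs <;> norm_num
  · have := hasHamiltonSubpairings_of_not_isBadPair hk hkm hms h
    rw [← fromEdgeSet_union, ← Finset.coe_union] at this
    exact (if_neg (not_not.2 this)).le.trans (indicatorOf_nonneg _ _)

end SimpleGraph

/-! ### Choice of constants and the limit. -/

theorem failure_bound_le_exp {n : ℕ} {q c x : ℝ} {k m : ℕ} (hc : c = 2 ^ 18)
    (hx : 1 ≤ x) (hqx : (n : ℝ) ≤ 2 * (q * x ^ 2)) (hqx' : q * x ^ 2 ≤ n) (hq : 0 ≤ q)
    (hxn : 6656 * x ≤ n) (hk : 10 * x ≤ k) (hm : 2 * (m : ℝ) ≤ 512 * x) :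
    4 ^ n * Real.exp (-(q * k ^ 2)) + 2 ^ n *
        (Real.exp (-(q * k ^ 2 / 2)) *
          (c ^ (2 * m) * Real.exp (q * ((2 * m : ℕ) : ℝ) ^ 2 / c))) ≤ 2 * Real.exp (-n) := by
  have hqk : 50 * (n : ℝ) ≤ q * k ^ 2 := by
    have : (10 * x) ^ 2 ≤ (k : ℝ) ^ 2 := by gcongr
    nlinarith
  have h2 : (2 : ℝ) ^ n ≤ Real.exp n := by
    rw [← mul_one (n : ℝ), Real.exp_nat_mul]
    gcongr
    linarith [Real.add_one_le_exp (1 : ℝ)]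
  have h4 : (4 : ℝ) ^ n ≤ Real.exp (2 * n) := by
    calc (4 : ℝ) ^ n = 2 ^ n * 2 ^ n := by rw [← mul_pow]; norm_num
      _ ≤ Real.exp n * Real.exp n := by gcongr
      _ = _ := by rw [← Real.exp_add]; ring_nf
  -- Here `18 log 2 < 13` and `13 · 512 = 6656`.
  have hcm : c ^ (2 * m) ≤ Real.exp n := by
    have hc13 : c ≤ Real.exp 13 := by
      rw [hc, ← Real.log_le_iff_le_exp (by norm_num), Real.log_pow]
      have := Real.log_two_lt_d9
      norm_num
      linarith
    calc c ^ (2 * m) ≤ Real.exp 13 ^ (2 * m) := by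
          have : 0 ≤ c := by rw [hc]; positivity
          gcongr
      _ = Real.exp ((2 * m) * 13) := by rw [← Real.exp_nat_mul]; push_cast; rfl
      _ ≤ _ := by
          gcongr
          linarith
  -- The value of `c` is `512²`, which cancels and leaves `q x² ≤ n`.
  have hqm : q * ((2 * m : ℕ) : ℝ) ^ 2 / c ≤ n := by
    rw [hc, div_le_iff₀ (by norm_num)]
    push_cast
    have : (2 * (m : ℝ)) ^ 2 ≤ (512 * x) ^ 2 := by gcongr
    nlinarith
  have hn : (0 : ℝ) ≤ n := n.cast_nonneg
  calc _ ≤ Real.exp (2 * n) * Real.exp (-(50 * n)) + Real.exp n * (Real.exp (-(50 * n / 2)) *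
          (Real.exp n * Real.exp n)) := by gcongr
    _ = Real.exp (-(48 * n)) + Real.exp (-(22 * n)) := by
        simp only [← Real.exp_add]
        ring_nf
    _ ≤ Real.exp (-n) + Real.exp (-n) := by
        gcongr <;> linarith
    _ = _ := by ring

/-- The hypothesis `hp` says `p = ω / n` (for all large `n`); as `p n ∈ [0, 1]`, it contains the
standing assumption `ω ≤ n`. -/
theorem mainTheorem2 (ω : ℕ → ℝ) (hω : Tendsto ω atTop atTop)
    (p : ℕ → I) (hp : ∀ᶠ n : ℕ in atTop, (p n : ℝ) = ω n / n) :
    Tendsto (fun n : ℕ => SimpleGraph.binomialRandom (Fin n) (p n)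
      {G : SimpleGraph (Fin n) | ∀ P : SetPairing (Fin n),
        510 * (n : ℝ) / √(ω n) ≤ (P.S.card : ℝ) →
          ∃ Q : SetPairing (Fin n), Q ⊆ P ∧ Q.S.Nonempty ∧
            HasHamiltonPath (G.induce (Q.S : Set (Fin n)))})
      atTop (𝓝 1) := by
  have hbound : ∀ᶠ n : ℕ in atTop, (SimpleGraph.binomialRandom (Fin n) (p n)).real
      {G | ¬ G.HasHamiltonSubpairings (510 * (n : ℝ) / √(ω n))} ≤ 2 * Real.exp (-(n : ℝ)) := by
    filter_upwards [hp, hω.eventually_ge_atTop (6656 ^ 2), eventually_gt_atTop 0] with n hpn hωn hn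
    have hn0 : (0 : ℝ) < n := by exact_mod_cast hn
    have hω0 : 0 < ω n := lt_of_lt_of_le (by norm_num) hωn
    have hp0 : (0 : ℝ) ≤ p n := (p n).2.1
    have hp1 : (p n : ℝ) ≤ 1 := (p n).2.2
    have hωle : ω n ≤ n := by
      rw [hpn, div_le_one hn0] at hp1
      exact hp1
    have hsq : √(ω n) ^ 2 = ω n := Real.sq_sqrt hω0.le
    have hsω : 6656 ≤ √(ω n) := Real.le_sqrt_of_sq_le hωn
    set x : ℝ := n / √(ω n) with hx
    have hs0 : 0 < √(ω n) := by linarith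
    have hx1 : 1 ≤ x := by
      rw [hx, one_le_div hs0]
      nlinarith
    have hxn : 6656 * x ≤ n := by
      rw [hx, mul_div_assoc', div_le_iff₀ hs0]
      nlinarith
    have hpx : (p n : ℝ) * x ^ 2 = n := by
      rw [hpn, hx, div_pow, hsq]
      field_simp
    -- The round density `q = 1 - r` solves `p = 1 - (1 - q)²`. Hence `p = q(1 + r)`, so `q ≤ p ≤
    -- 2q`; multiplied by `x²`, this gives the two bounds on `q x²`.
    set r := √(1 - (p n : ℝ)) with hr
    have hr2 : r ^ 2 = 1 - p n := Real.sq_sqrt (by linarith)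
    have hr0 : 0 ≤ r := Real.sqrt_nonneg _
    have hr1 : r ≤ 1 := by nlinarith
    have hk1 := Nat.le_ceil (10 * x)
    have hk2 := Nat.ceil_lt_add_one (a := 10 * x) (by linarith)
    have hm1 := Nat.le_ceil (255 * x)
    have hm2 := Nat.ceil_lt_add_one (a := 255 * x) (by linarith)
    -- With `m = ⌈255x⌉`, rounding costs at most 2, so `2m ≤ 510x + 2 ≤ 512x` because `x ≥ 1`.
    have hb := SimpleGraph.binomialRandom_real_not_hasHamiltonSubpairings_le (V := Fin n) (p n)
      (q := 1 - r) (c := 2 ^ 18) (s := 510 * (n : ℝ) / √(ω n)) (by linarith) (by linarith)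
      (by rw [sub_sub_cancel, hr2, sub_sub_cancel]) (by norm_num)
      (k := ⌈10 * x⌉₊) (m := ⌈255 * x⌉₊) (Nat.ceil_pos.2 (by linarith))
      (by
        have : 11 * (⌈10 * x⌉₊ : ℝ) ≤ 2 * ⌈255 * x⌉₊ := by linarith
        exact_mod_cast this)
      (by
        rw [mul_div_assoc, ← hx]
        linarith)
    rw [Fintype.card_fin] at hb
    refine hb.trans (failure_bound_le_exp (x := x) rfl hx1 ?_ ?_ (by linarith) hxn hk1
      (by linarith))
    · nlinarith [sq_nonneg x, mul_nonneg (sq_nonneg x) (sq_nonneg (1 - r))]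
    · nlinarith [sq_nonneg x, mul_nonneg (sq_nonneg x) (mul_nonneg hr0 (sub_nonneg.2 hr1))]
  have hlim : Tendsto (fun n : ℕ => (SimpleGraph.binomialRandom (Fin n) (p n)).real
      {G | ¬ G.HasHamiltonSubpairings (510 * (n : ℝ) / √(ω n))}) atTop (𝓝 0) := by
    refine squeeze_zero' (.of_forall fun _ => measureReal_nonneg) hbound ?_
    rw [← mul_zero (2 : ℝ)]
    exact (Real.tendsto_exp_neg_atTop_nhds_zero.comp tendsto_natCast_atTop_atTop).const_mul 2
  have hone : Tendsto (fun n : ℕ => (SimpleGraph.binomialRandom (Fin n) (p n)).real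
      {G | G.HasHamiltonSubpairings (510 * (n : ℝ) / √(ω n))}) atTop (𝓝 1) := by
    rw [← sub_zero (1 : ℝ)]
    refine (hlim.const_sub 1).congr fun n => ?_
    rw [SimpleGraph.binomialRandom_real_eq_bernoulliSum,
      SimpleGraph.binomialRandom_real_eq_bernoulliSum, sub_eq_iff_eq_add, ← bernoulliSum_add,
      ← bernoulliSum_const (⊤ : SimpleGraph (Fin n)).edgeFinset (p n) 1]
    refine bernoulliSum_congr fun A _ => ?_
    unfold indicatorOf
    split_ifs <;> simp_all
  refine ((ENNReal.tendsto_ofReal hone).congr fun n => ?_).trans (by rw [ENNReal.ofReal_one])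
  exact ofReal_measureReal
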